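/- Let $q,a,b$ be nonzero complex numbers with $q^m\neq 1$ for all integers $m\geq 1$. Let $\mathcal H_{\rm III}$ be the associative unital $\mathbb C$-algebra generated by $T_0$, $T_1$, $X$, $X^{-1}$ with relations $XX^{-1}=X^{-1}X=1$ and $$(T_1+ab)(T_1+1)=0,\qquad T_0^2=0,\qquad (T_1X+a)(T_1X+b)=0,\qquad qT_0X^{-1}+1=XT_0 .$$ Then $\mathcal H_{\rm III}$ has a faithful representation (an injective homomorphism of unital $\mathbb C$-algebras into the linear endomorphisms) on the space $\mathcal A=\mathbb C[z,z^{-1}]$ of Laurent polynomials $f[z]$, given by $$(T_0f)[z]=-\frac{z}{q-z^2}\bigl(f[z]-f[qz^{-1}]\bigr),$$ $$(T_1f)[z]=\frac{(a+b)z-(1+ab)}{1-z^2}\,f[z]+\frac{(1-az)(1-bz)}{1-z^2}\,f[z^{-1}],$$ $$(Xf)[z]=z\,f[z].$$ -/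

import Mathlib

noncomputable section

namespace ConfluentCherednik

/-- The four generators `T₀`, `T₁`, `X`, `X⁻¹`. -/
inductive Gen : Type
  | T0 | T1 | X | Xinv

/-- The corresponding free generators of the free associative unital complex algebra. -/
abbrev gen (g : Gen) : FreeAlgebra ℂ Gen := FreeAlgebra.ι ℂ g

/-- The defining relations of the algebra `H_III` with parameters `q`, `a`, `b`
(the first two say that `X⁻¹` is the two-sided inverse of `X`). -/
inductive Rel (q a b : ℂ) : FreeAlgebra ℂ Gen → FreeAlgebra ℂ Gen → Prop
  | X_mul_Xinv : Rel q a b (gen .X * gen .Xinv) 1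
  | Xinv_mul_X : Rel q a b (gen .Xinv * gen .X) 1
  | quadratic_T1 : Rel q a b
      ((gen .T1 + algebraMap ℂ _ (a * b)) * (gen .T1 + 1)) 0
  | quadratic_T0 : Rel q a b (gen .T0 ^ 2) 0
  | quadratic_T1X : Rel q a b
      ((gen .T1 * gen .X + algebraMap ℂ _ a) * (gen .T1 * gen .X + algebraMap ℂ _ b)) 0
  | exchange : Rel q a b
      (algebraMap ℂ _ q * gen .T0 * gen .Xinv + 1) (gen .X * gen .T0)

/-- The algebra `H_III`: the quotient of the free algebra by the two-sided ideal generated by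
the relations. -/
abbrev HIII (q a b : ℂ) : Type := RingQuot (Rel q a b)

/-- The generators of `H_III`. -/
def HIII.gen (q a b : ℂ) (g : Gen) : HIII q a b :=
  RingQuot.mkAlgHom ℂ (Rel q a b) (ConfluentCherednik.gen g)

/-- The space of complex Laurent polynomials in the variable `z`
(which is `LaurentPolynomial.T 1` in Mathlib). -/
abbrev Laurent : Type := LaurentPolynomial ℂ

/-- The unit `c z⁻¹` of the ring of Laurent polynomials. -/
def invVar (c : ℂˣ) : Laurentˣ where
  val := LaurentPolynomial.C (c : ℂ) * LaurentPolynomial.T (-1)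
  inv := LaurentPolynomial.C ((c⁻¹ : ℂˣ) : ℂ) * LaurentPolynomial.T 1
  val_inv := by
    rw [mul_mul_mul_comm, ← map_mul, ← LaurentPolynomial.T_add]
    simp
  inv_val := by
    rw [mul_mul_mul_comm, ← map_mul, ← LaurentPolynomial.T_add]
    simp

/-- The substitution `f[z] ↦ f[c z⁻¹]` on Laurent polynomials. -/
def reflect (c : ℂˣ) : Laurent →+* Laurent :=
  LaurentPolynomial.eval₂ LaurentPolynomial.C (invVar c)

/-- The field of rational functions in `z`, as fraction field of the Laurent polynomials. -/
abbrev Rational : Type := FractionRing Laurent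

/-- A Laurent polynomial regarded as a rational function. -/
abbrev toRat : Laurent →+* Rational := algebraMap Laurent Rational

/-- The variable `z` as a rational function. -/
def z : Rational := toRat (LaurentPolynomial.T 1)

/-- A complex number as a constant rational function. -/
def const : ℂ →+* Rational := toRat.comp LaurentPolynomial.C

end ConfluentCherednik

end

noncomputable section

namespace ConfluentCherednik

open LaurentPolynomial

/-! The formulas preserve Laurent polynomials because `c - z²` divides `f[z] - f[c z⁻¹]`; the
relations are then identities between rational functions.

For faithfulness, the relations let `T₀` and `T₁` be moved to the right past `X` and `X⁻¹`, and
reduce products of `T₀`, `T₁` to alternating words. Hence every element of the algebra is a sum of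
terms `f_n(X) w_n`, with `w_n` the alternating words indexed by the integers
(`normalForm_surjective`).

In the representation, `w_n` expands over the field of rational functions in the elements of the
infinite dihedral group generated by `z ↦ q z⁻¹` and `z ↦ z⁻¹`: the n-th element has a nonzero
coefficient and all others are shorter (`triangular_word`). As `q` is not a root of unity, these
elements are distinct, so they are independent by Dedekind's theorem
(`linearIndependent_character`). By triangularity the operators of the `w_n` are independent too, so
a normal form acting as zero has all `f_n = 0`. -/

/-! ### Alternating words -/

/-- The alternating product `u * v * u * ⋯` with `n` factors. -/
def alternating {R : Type*} [Monoid R] (u v : R) : ℕ → R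
  | 0 => 1
  | n + 1 => u * alternating v u n

/-- The reduced words of the infinite dihedral group, indexed by integers: the alternating product
with `|n|` factors which starts with `u` for `n > 0` and with `v` for `n < 0`. -/
def word {R : Type*} [Monoid R] (u v : R) : ℤ → R
  | .ofNat n => alternating u v n
  | .negSucc n => alternating v u (n + 1)

section Word

variable {R : Type*} [Monoid R] (u v : R)

@[simp]
theorem word_zero : word u v 0 = 1 := rfl

theorem word_swap (n : ℤ) : word u v (-n) = word v u n := by
  rcases n with (_ | n) | n <;> rfl

/-- The letters act on indices by the reflections `n ↦ 1 - n` and `n ↦ -1 - n`. The sign condition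
says that the longer word is still reduced, so no relation on `u`, `v` is needed. -/
theorem mul_word_of_nonpos {n : ℤ} (hn : n ≤ 0) : u * word u v n = word u v (1 - n) := by
  obtain ⟨k, rfl⟩ := Int.exists_eq_neg_ofNat hn
  rw [word_swap, sub_neg_eq_add, add_comm]
  rfl

theorem mul_word_of_nonneg {n : ℤ} (hn : 0 ≤ n) : v * word u v n = word u v (-1 - n) := by
  have h := mul_word_of_nonpos v u (n := -n) (by omega)
  rw [word_swap] at h
  rw [h, ← word_swap]
  congr 1
  ring

end Word

/-- A family which is triangular with respect to a linearly independent family indexed by the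
integers, filtered by the absolute value, is linearly independent. -/
theorem linearIndependent_of_triangular {K M : Type*} [Field K] [AddCommGroup M] [Module K M]
    {v w : ℤ → M} (hv : LinearIndependent K v)
    (h : ∀ n, ∃ c : K, c ≠ 0 ∧
      w n - c • v n ∈ Submodule.span K (v '' {m | m.natAbs < n.natAbs})) :
    LinearIndependent K w := by
  rw [linearIndependent_iff]
  intro l hl
  by_contra hne
  -- Since `-n` may also lie in the support, the contradiction is that `v n` lies in the span over
  -- all other indices, not just over shorter ones.
  obtain ⟨n, hn, hmax⟩ := l.support.exists_max_image Int.natAbs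
    (Finsupp.support_nonempty_iff.2 hne)
  obtain ⟨c, hc, hcn⟩ := h n
  have hlow : ∀ m : ℤ, m.natAbs ≤ n.natAbs →
      Submodule.span K (v '' {k : ℤ | k.natAbs < m.natAbs}) ≤ Submodule.span K (v '' {n}ᶜ) := by
    refine fun m hm => Submodule.span_mono (Set.image_mono ?_)
    rintro k hk rfl
    exact absurd hk (by simpa using hm)
  refine hv.notMem_span_image (s := {n}ᶜ) (x := n) (by simp) ?_
  rw [Finsupp.linearCombination_apply, Finsupp.sum, ← Finset.add_sum_erase _ _ hn] at hl
  have hrest : ∑ m ∈ l.support.erase n, l m • w m ∈ Submodule.span K (v '' {n}ᶜ) := by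
    refine Submodule.sum_mem _ fun m hm => Submodule.smul_mem _ _ ?_
    obtain ⟨hmn, hm⟩ := Finset.mem_erase.1 hm
    obtain ⟨d, -, hd⟩ := h m
    rw [← sub_add_cancel (w m) (d • v m)]
    exact add_mem (hlow m (hmax m hm) hd)
      (Submodule.smul_mem _ _ (Submodule.subset_span ⟨m, hmn, rfl⟩))
  have hw : w n ∈ Submodule.span K (v '' {n}ᶜ) := by
    have h0 : l n • w n ∈ Submodule.span K (v '' {n}ᶜ) := by
      rw [eq_neg_of_add_eq_zero_left hl]
      exact neg_mem hrest
    exact (Submodule.smul_mem_iff _ (Finsupp.mem_support_iff.1 hn)).1 h0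
  have := sub_mem hw (hlow n le_rfl hcn)
  rw [sub_sub_cancel] at this
  exact (Submodule.smul_mem_iff _ hc).1 this

/-! ### Reflections of the variable -/

theorem T_mul_T_neg (n : ℤ) : (T n * T (-n) : Laurent) = 1 := by
  rw [← T_add, add_neg_cancel, T_zero]

/-- Ring homomorphisms on Laurent polynomials are determined by constants and the variable. -/
theorem laurent_hom_ext {S : Type*} [Ring S] {f g : Laurent →+* S}
    (hC : ∀ c, f (C c) = g (C c)) (hT : f (T 1) = g (T 1)) : f = g := by
  have hu : f (T (-1)) = g (T (-1)) := by
    have h1 : f (T (-1)) * f (T 1) = 1 := by rw [← map_mul, T_mul, T_mul_T_neg, map_one]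
    have h2 : g (T 1) * g (T (-1)) = 1 := by rw [← map_mul, T_mul_T_neg, map_one]
    rw [← hT] at h2
    exact left_inv_eq_right_inv h1 h2
  refine RingHom.ext fun p => ?_
  induction p using LaurentPolynomial.induction_on with
  | h_C a => exact hC a
  | h_add hp hq => rw [map_add, map_add, hp, hq]
  | h_C_mul_T n a h => rw [T_add, ← mul_assoc, map_mul, map_mul g, h, hT]
  | h_C_mul_T_Z n a h => rw [sub_eq_add_neg, T_add, ← mul_assoc, map_mul, map_mul g, h, hu]

@[simp]
theorem reflect_C (c : ℂˣ) (x : ℂ) : reflect c (C x) = C x := by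
  simp [reflect]

@[simp]
theorem reflect_T_one (c : ℂˣ) : reflect c (T 1) = C (c : ℂ) * T (-1) := by
  simp [reflect, invVar]

theorem C_mul_C_inv (c : ℂˣ) : (C (c : ℂ) * C (c : ℂ)⁻¹ : Laurent) = 1 := by
  rw [← map_mul, mul_inv_cancel₀ c.ne_zero, map_one]

@[simp]
theorem reflect_T_neg_one (c : ℂˣ) : reflect c (T (-1)) = C (c : ℂ)⁻¹ * T 1 := by
  simp [reflect, invVar]

theorem reflect_reflect (c : ℂˣ) (f : Laurent) : reflect c (reflect c f) = f := by
  have : (reflect c).comp (reflect c) = RingHom.id Laurent := by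
    refine laurent_hom_ext (by simp) ?_
    simp only [RingHom.comp_apply, reflect_T_one, map_mul, reflect_C, reflect_T_neg_one,
      ← mul_assoc, C_mul_C_inv, one_mul, RingHom.id_apply]
  exact DFunLike.congr_fun this f

theorem toRat_injective : Function.Injective toRat := IsFractionRing.injective Laurent Rational

/-- The extension of `reflect c` to rational functions. -/
def reflectRat (c : ℂˣ) : Rational →+* Rational :=
  IsFractionRing.lift (g := toRat.comp (reflect c))
    (toRat_injective.comp (Function.LeftInverse.injective (reflect_reflect c)))

@[simp]
theorem reflectRat_toRat (c : ℂˣ) (f : Laurent) :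
    reflectRat c (toRat f) = toRat (reflect c f) :=
  IsFractionRing.lift_algebraMap _ f

theorem z_ne_zero : z ≠ 0 := by
  rw [z, map_ne_zero_iff _ toRat_injective]
  exact (isUnit_T 1).ne_zero

theorem toRat_T_one : toRat (T 1) = z := rfl

theorem toRat_T_neg_one : toRat (T (-1)) = z⁻¹ := by
  refine eq_inv_of_mul_eq_one_left ?_
  rw [z, ← map_mul, T_mul, T_mul_T_neg, map_one]

theorem toRat_C (x : ℂ) : toRat (C x) = const x := rfl

@[simp]
theorem reflectRat_const (c : ℂˣ) (x : ℂ) : reflectRat c (const x) = const x := by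
  rw [← toRat_C, reflectRat_toRat, reflect_C]

@[simp]
theorem reflectRat_z (c : ℂˣ) : reflectRat c z = const c * z⁻¹ := by
  rw [z, reflectRat_toRat, reflect_T_one, map_mul, toRat_C, toRat_T_neg_one, z]

theorem const_ne_zero {x : ℂ} (hx : x ≠ 0) : const x ≠ 0 :=
  (map_ne_zero const).2 hx

theorem linear_ne_zero (x : ℂ) : 1 - const x * z ≠ 0 := by
  rw [z, ← toRat_C, ← map_mul, ← map_one toRat, ← map_sub, map_ne_zero_iff _ toRat_injective]
  intro h
  have := congrArg (fun f : Laurent => f.coeff 0) h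
  simp [← single_eq_C_mul_T, ← single_zero_one_eq_one] at this

theorem const_sub_z_sq_ne_zero {x : ℂ} (hx : x ≠ 0) : const x - z ^ 2 ≠ 0 := by
  -- A square root of the constant splits the quadratic into linear factors.
  obtain ⟨y, rfl⟩ := IsAlgClosed.exists_pow_nat_eq x two_pos
  have hy : y ≠ 0 := by rintro rfl; simp at hx
  have h1 := linear_ne_zero y⁻¹
  have h2 := linear_ne_zero (-y⁻¹)
  have h3 := const_ne_zero hy
  rw [map_neg] at h2
  rw [map_inv₀] at h1 h2
  have : const (y ^ 2) - z ^ 2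
      = const y ^ 2 * ((1 - (const y)⁻¹ * z) * (1 - -(const y)⁻¹ * z)) := by
    rw [map_pow]
    field_simp
    ring
  rw [this]
  exact mul_ne_zero (pow_ne_zero _ h3) (mul_ne_zero h1 h2)

/-! ### Divided differences -/

/-- Modulo `c - z²` one has `z = c z⁻¹`, so the reflection induces the identity on the quotient
ring. -/
theorem dvd_sub_reflect (c : ℂˣ) (f : Laurent) :
    C (c : ℂ) - T 2 ∣ f - reflect c f := by
  rw [← Ideal.mem_span_singleton, ← Ideal.Quotient.eq]
  have : (Ideal.Quotient.mk (Ideal.span {C (c : ℂ) - T 2})) =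
      (Ideal.Quotient.mk (Ideal.span {C (c : ℂ) - T 2})).comp (reflect c) := by
    refine laurent_hom_ext (by simp) ?_
    rw [RingHom.comp_apply, Ideal.Quotient.eq, Ideal.mem_span_singleton, reflect_T_one]
    refine ⟨-T (-1), ?_⟩
    rw [mul_neg, sub_mul, neg_sub, ← T_add]
    norm_num
  exact DFunLike.congr_fun this f

theorem exists_toRat_eq_dividedDiff (c : ℂˣ) (f : Laurent) :
    ∃ g, toRat g = (toRat f - toRat (reflect c f)) / (const c - z ^ 2) := by
  obtain ⟨g, hg⟩ := dvd_sub_reflect c f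
  refine ⟨g, eq_div_of_mul_eq (const_sub_z_sq_ne_zero c.ne_zero) ?_⟩
  rw [← map_sub, hg, map_mul, map_sub, toRat_C, ← toRat_T_one, ← map_pow, T_pow, mul_comm]
  rfl

/-- The divided difference `f ↦ (f[z] - f[c z⁻¹]) / (c - z²)` as a function. -/
def dividedDiffFun (c : ℂˣ) (f : Laurent) : Laurent := (exists_toRat_eq_dividedDiff c f).choose

theorem toRat_dividedDiffFun (c : ℂˣ) (f : Laurent) :
    toRat (dividedDiffFun c f) = (toRat f - toRat (reflect c f)) / (const c - z ^ 2) :=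
  (exists_toRat_eq_dividedDiff c f).choose_spec

/-- The divided difference `f ↦ (f[z] - f[c z⁻¹]) / (c - z²)` as a linear map. -/
def dividedDiff (c : ℂˣ) : Laurent →ₗ[ℂ] Laurent where
  toFun := dividedDiffFun c
  map_add' f g := toRat_injective <| by
    simp only [map_add, toRat_dividedDiffFun]
    ring
  map_smul' x f := toRat_injective <| by
    simp only [smul_eq_C_mul, map_mul, toRat_dividedDiffFun, reflect_C, RingHom.id_apply]
    ring

theorem toRat_dividedDiff (c : ℂˣ) (f : Laurent) :
    toRat (dividedDiff c f) = (toRat f - toRat (reflect c f)) / (const c - z ^ 2) :=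
  toRat_dividedDiffFun c f

/-! ### The representation -/

/-- Multiplication by a Laurent polynomial. -/
abbrev mulOp (f : Laurent) : Module.End ℂ Laurent := LinearMap.mulLeft ℂ f

/-- The operator by which `T₀` acts. -/
def opT0 (c : ℂˣ) : Module.End ℂ Laurent := -(mulOp (T 1) * dividedDiff c)

/-- The operator by which `T₁` acts. -/
def opT1 (a b : ℂ) : Module.End ℂ Laurent :=
  -(mulOp ((1 - C a * T 1) * (1 - C b * T 1)) * dividedDiff 1) - algebraMap ℂ _ (a * b)

theorem one_sub_z_sq_ne_zero : 1 - z ^ 2 ≠ 0 := by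
  simpa using const_sub_z_sq_ne_zero one_ne_zero

theorem toRat_opT0 (c : ℂˣ) (f : Laurent) :
    toRat (opT0 c f) = -(z / (const c - z ^ 2)) * (toRat f - toRat (reflect c f)) := by
  simp only [opT0, LinearMap.neg_apply, Module.End.mul_apply, LinearMap.mulLeft_apply, map_neg,
    map_mul, toRat_dividedDiff, toRat_T_one]
  ring

/-- Rests on `(a + b)z - (1 + ab) + (1 - az)(1 - bz) = -ab(1 - z²)`, which explains the constant
term in `opT1`. -/
theorem toRat_opT1 (a b : ℂ) (f : Laurent) :
    toRat (opT1 a b f) =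
      (const (a + b) * z - const (1 + a * b)) / (1 - z ^ 2) * toRat f +
        (1 - const a * z) * (1 - const b * z) / (1 - z ^ 2) * toRat (reflect 1 f) := by
  have := one_sub_z_sq_ne_zero
  simp only [opT1, LinearMap.sub_apply, LinearMap.neg_apply, Module.End.mul_apply,
    LinearMap.mulLeft_apply, Module.algebraMap_end_apply, smul_eq_C_mul, map_sub, map_neg, map_mul,
    map_add, map_one, toRat_dividedDiff, toRat_C, Units.val_one, toRat_T_one]
  field_simp
  ring

theorem toRat_mulOp_T_one (f : Laurent) : toRat (mulOp (T 1) f) = z * toRat f := by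
  rw [LinearMap.mulLeft_apply, map_mul, toRat_T_one]

/-- The images of the generators in the representation. -/
def opGen (c : ℂˣ) (a b : ℂ) : Gen → Module.End ℂ Laurent
  | .T0 => opT0 c
  | .T1 => opT1 a b
  | .X => mulOp (T 1)
  | .Xinv => mulOp (T (-1))

/-- Both `z / (c - z²) = 1 / (c z⁻¹ - z)` and `f[z] - f[c z⁻¹]` change sign under the reflection.
Invariance of the image gives `T₀² = 0`. -/
theorem toRat_reflect_opT0 (c : ℂˣ) (f : Laurent) :
    toRat (reflect c (opT0 c f)) = toRat (opT0 c f) := by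
  have hz := z_ne_zero
  have hc := const_ne_zero c.ne_zero
  have h1 := const_sub_z_sq_ne_zero c.ne_zero
  have h2 : z ^ 2 - const c ≠ 0 := by rwa [← neg_ne_zero, neg_sub]
  rw [← reflectRat_toRat, toRat_opT0]
  simp only [map_mul, map_neg, map_div₀, map_sub, map_pow, reflectRat_toRat, reflect_reflect,
    reflectRat_z, reflectRat_const]
  have h3 : const c - (const c * z⁻¹) ^ 2 = const c * (z ^ 2 - const c) * z⁻¹ ^ 2 := by
    field_simp
  rw [h3]
  field_simp
  ring

theorem opT0_sq (c : ℂˣ) : opT0 c ^ 2 = 0 := by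
  refine LinearMap.ext fun f => toRat_injective ?_
  rw [pow_two, Module.End.mul_apply, toRat_opT0, toRat_reflect_opT0]
  simp

theorem opT0_exchange (c : ℂˣ) :
    algebraMap ℂ _ (c : ℂ) * opT0 c * mulOp (T (-1)) + 1 = mulOp (T 1) * opT0 c := by
  refine LinearMap.ext fun f => toRat_injective ?_
  have hz := z_ne_zero
  have hc := const_ne_zero c.ne_zero
  have h1 := const_sub_z_sq_ne_zero c.ne_zero
  simp only [LinearMap.add_apply, Module.End.mul_apply, Module.algebraMap_end_apply,
    Module.End.one_apply, smul_eq_C_mul, map_add, map_mul, toRat_opT0, toRat_C,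
    LinearMap.mulLeft_apply, reflect_T_neg_one, toRat_T_neg_one,
    toRat_T_one, map_inv₀]
  field_simp
  ring

theorem opT1_quadratic (a b : ℂ) :
    (opT1 a b + algebraMap ℂ _ (a * b)) * (opT1 a b + 1) = 0 := by
  refine LinearMap.ext fun f => toRat_injective ?_
  have hz := z_ne_zero
  have h1 := one_sub_z_sq_ne_zero
  have h2 : z ^ 2 - 1 ≠ 0 := by rwa [← neg_ne_zero, neg_sub]
  -- Brings the reflected denominator to a form whose factors are known to be nonzero.
  have h3 : 1 - z⁻¹ ^ 2 = (z ^ 2 - 1) * z⁻¹ ^ 2 := by field_simp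
  simp only [LinearMap.add_apply, Module.End.mul_apply, Module.algebraMap_end_apply,
    Module.End.one_apply, LinearMap.zero_apply, smul_eq_C_mul, map_add, map_mul, toRat_opT1,
    toRat_C, map_zero, map_one, map_sub, map_div₀, map_pow, ← reflectRat_toRat,
    reflectRat_z, reflectRat_const, Units.val_one, one_mul, h3]
  simp only [reflectRat_toRat, reflect_reflect]
  have h4 : 1 - z ^ 2 = -(z ^ 2 - 1) := by ring
  rw [h4]
  field_simp
  ring

theorem opT1_mul_X_quadratic (a b : ℂ) :
    (opT1 a b * mulOp (T 1) + algebraMap ℂ _ a) * (opT1 a b * mulOp (T 1) + algebraMap ℂ _ b)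
      = 0 := by
  refine LinearMap.ext fun f => toRat_injective ?_
  have hz := z_ne_zero
  have h1 := one_sub_z_sq_ne_zero
  have h2 : z ^ 2 - 1 ≠ 0 := by rwa [← neg_ne_zero, neg_sub]
  have h3 : 1 - z⁻¹ ^ 2 = (z ^ 2 - 1) * z⁻¹ ^ 2 := by field_simp
  simp only [LinearMap.add_apply, Module.End.mul_apply, Module.algebraMap_end_apply,
    LinearMap.zero_apply, smul_eq_C_mul, map_add, map_mul, toRat_opT1, toRat_mulOp_T_one,
    toRat_C, map_zero, map_one, map_sub, map_div₀, map_pow, ← reflectRat_toRat,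
    reflectRat_z, reflectRat_const, Units.val_one, one_mul, h3]
  simp only [map_inv₀, reflectRat_toRat, reflect_reflect, reflectRat_z,
    Units.val_one, map_one, one_mul]
  have h4 : 1 - z ^ 2 = -(z ^ 2 - 1) := by ring
  rw [h4]
  field_simp
  ring

/-- The representation of `H_III` on Laurent polynomials. -/
def representation (c : ℂˣ) (a b : ℂ) : HIII c a b →ₐ[ℂ] Module.End ℂ Laurent :=
  RingQuot.liftAlgHom ℂ ⟨FreeAlgebra.lift ℂ (opGen c a b), by
    have hX : ∀ m n : ℤ, m + n = 0 → mulOp (T m) * mulOp (T n) = 1 := fun m n h =>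
      LinearMap.ext fun f => by simp [← mul_assoc, ← T_add, h, -T_mul]
    rintro _ _ (_ | _ | _ | _ | _ | _) <;>
      simp only [gen, map_mul, map_add, map_pow, map_one, map_zero, FreeAlgebra.lift_ι_apply,
        AlgHom.commutes, opGen]
    exacts [hX _ _ (by simp), hX _ _ (by simp),
      by simpa only [map_mul] using opT1_quadratic a b, opT0_sq c, opT1_mul_X_quadratic a b, opT0_exchange c]⟩

@[simp]
theorem representation_gen (c : ℂˣ) (a b : ℂ) (g : Gen) :
    representation c a b (HIII.gen c a b g) = opGen c a b g := by
  rw [representation, HIII.gen, RingQuot.liftAlgHom_mkAlgHom_apply, gen, FreeAlgebra.lift_ι_apply]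

/-! ### The characters given by the dihedral group -/

/-- The action on Laurent polynomials of the infinite dihedral group generated by the reflections
`z ↦ c z⁻¹` and `z ↦ z⁻¹`. -/
def dihedral (c : ℂˣ) (n : ℤ) : Laurent →+* Laurent :=
  word (reflect c) (reflect 1) n

/-- Reflections are involutions, so here the index rule holds without the sign condition. -/
theorem reflect_comp_dihedral (c : ℂˣ) (n : ℤ) :
    (reflect c).comp (dihedral c n) = dihedral c (1 - n) := by
  rcases le_or_gt n 0 with hn | hn
  · exact mul_word_of_nonpos _ _ hn
  · have h : dihedral c n = (reflect c).comp (dihedral c (1 - n)) := by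
      have := mul_word_of_nonpos (reflect c) (reflect 1) (n := 1 - n) (by omega)
      rw [sub_sub_cancel] at this
      exact this.symm
    rw [h]
    exact RingHom.ext fun f => reflect_reflect c _

theorem reflect_one_comp_dihedral (c : ℂˣ) (n : ℤ) :
    (reflect 1).comp (dihedral c n) = dihedral c (-1 - n) := by
  rcases le_or_gt 0 n with hn | hn
  · exact mul_word_of_nonneg _ _ hn
  · have h : dihedral c n = (reflect 1).comp (dihedral c (-1 - n)) := by
      have := mul_word_of_nonneg (reflect c) (reflect 1) (n := -1 - n) (by omega)
      rw [sub_sub_cancel] at this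
      exact this.symm
    rw [h]
    exact RingHom.ext fun f => reflect_reflect 1 _

theorem dihedral_even_T_one (c : ℂˣ) (k : ℤ) :
    dihedral c (2 * k) (T 1) = C ((c ^ (-k) : ℂˣ) : ℂ) * T 1 := by
  have hc := c.ne_zero
  induction k with
  | zero => simp [dihedral, -T_mul]
  | succ k ih =>
    have h : dihedral c (2 * (k + 1)) =
        (reflect c).comp ((reflect 1).comp (dihedral c (2 * k))) := by
      rw [reflect_one_comp_dihedral, reflect_comp_dihedral]
      congr 1
      ring
    rw [h, RingHom.comp_apply, RingHom.comp_apply, ih]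
    simp only [map_mul, reflect_C, reflect_T_one, reflect_T_neg_one, Units.val_one, map_one,
      one_mul, ← mul_assoc]
    rw [← map_mul]
    congr 2
    rw [neg_add, zpow_add, zpow_neg_one, Units.val_mul, Units.val_inv_eq_inv_val]
  | pred k ih =>
    have h : dihedral c (2 * (-k - 1)) =
        (reflect 1).comp ((reflect c).comp (dihedral c (2 * -k))) := by
      rw [reflect_comp_dihedral, reflect_one_comp_dihedral]
      congr 1
      ring
    rw [h, RingHom.comp_apply, RingHom.comp_apply, ih]
    simp only [map_mul, reflect_C, reflect_T_one, reflect_T_neg_one, Units.val_one, map_one,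
      inv_one, one_mul, ← mul_assoc]
    rw [← map_mul]
    congr 2
    rw [neg_sub, sub_eq_add_neg, add_comm, zpow_add, zpow_one, Units.val_mul]

theorem dihedral_odd_T_one (c : ℂˣ) (k : ℤ) :
    dihedral c (2 * k + 1) (T 1) = C ((c ^ (k + 1) : ℂˣ) : ℂ) * T (-1) := by
  have h : dihedral c (2 * k + 1) = (reflect c).comp (dihedral c (2 * -k)) := by
    rw [reflect_comp_dihedral]
    congr 1
    ring
  rw [h, RingHom.comp_apply, dihedral_even_T_one, neg_neg, map_mul, reflect_C, reflect_T_one,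
    ← mul_assoc, ← map_mul, zpow_add, zpow_one, Units.val_mul]

theorem C_mul_T_inj {x y : ℂ} (hx : x ≠ 0) {m n : ℤ} (h : (C x * T m : Laurent) = C y * T n) :
    m = n ∧ x = y := by
  have hm := congrArg (fun f : Laurent => f.coeff m) h
  simp only [← single_eq_C_mul_T, AddMonoidAlgebra.coeff_single, Finsupp.single_apply] at hm
  by_cases hmn : n = m
  · simpa [hmn] using hm
  · simp [hmn, hx] at hm

/-- The image of `z` suffices: its exponent gives the parity of the index, and its coefficient, a
power of an element of infinite order, gives the rest. -/
theorem dihedral_injective {c : ℂˣ} (hc : ∀ m : ℕ, 1 ≤ m → (c : ℂ) ^ m ≠ 1) :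
    Function.Injective (dihedral c) := by
  have hpow : Function.Injective fun k : ℤ => c ^ k := by
    rw [injective_zpow_iff_not_isOfFinOrder, isOfFinOrder_iff_pow_eq_one]
    rintro ⟨m, hm, h⟩
    exact hc m hm (by rw [← Units.val_pow_eq_pow_val, h, Units.val_one])
  intro m n h
  have hT := DFunLike.congr_fun h (T 1)
  obtain ⟨j, rfl | rfl⟩ := Int.even_or_odd' m <;> obtain ⟨k, rfl | rfl⟩ := Int.even_or_odd' n <;>
    simp only [dihedral_even_T_one, dihedral_odd_T_one] at hT <;>
    obtain ⟨h1, h2⟩ := C_mul_T_inj (Units.ne_zero _) hT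
  · have := hpow (Units.val_injective h2)
    omega
  · omega
  · omega
  · have := hpow (Units.val_injective h2)
    omega

/-- The elements of the dihedral group as functions with values in rational functions. -/
def character (c : ℂˣ) (n : ℤ) : Laurent → Rational := fun f => toRat (dihedral c n f)

theorem linearIndependent_character {c : ℂˣ} (hc : ∀ m : ℕ, 1 ≤ m → (c : ℂ) ^ m ≠ 1) :
    LinearIndependent Rational (character c) := by
  refine (linearIndependent_monoidHom Laurent Rational).comp
    (fun n => ((toRat.comp (dihedral c n) : Laurent →+* Rational) : Laurent →* Rational)) ?_
  intro m n h
  refine dihedral_injective hc (RingHom.ext fun f => toRat_injective ?_)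
  exact DFunLike.congr_fun h f

/-! ### Triangularity -/

/-- The span of the characters of length less than `N`. -/
abbrev lowerSpan (c : ℂˣ) (N : ℕ) : Submodule Rational (Laurent → Rational) :=
  Submodule.span Rational (character c '' {m | m.natAbs < N})

/-- A Demazure–Lusztig type operator adds one to the length of the leading character. -/
theorem triangular_step (c d : ℂˣ) (τ : ℤ → ℤ)
    (hτ : ∀ m, (reflect d).comp (dihedral c m) = dihedral c (τ m))
    (hτ_le : ∀ m, (τ m).natAbs ≤ m.natAbs + 1)
    (t : Module.End ℂ Laurent) (α β : Rational) (hβ : β ≠ 0)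
    (ht : ∀ f, toRat (t f) = α * toRat f + β * toRat (reflect d f))
    (w : Module.End ℂ Laurent) (n : ℤ) (hn : (τ n).natAbs = n.natAbs + 1)
    (hw : ∃ k : Rational, k ≠ 0 ∧
      (fun f => toRat (w f)) - k • character c n ∈ lowerSpan c n.natAbs) :
    ∃ k : Rational, k ≠ 0 ∧
      (fun f => toRat ((t * w) f)) - k • character c (τ n) ∈ lowerSpan c (τ n).natAbs := by
  obtain ⟨k, hk, hmem⟩ := hw
  have hχ : ∀ m f, reflectRat d (character c m f) = character c (τ m) f := fun m f => by
    rw [character, reflectRat_toRat, character, ← hτ, RingHom.comp_apply]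
  -- The reflection acts semilinearly, twisting the coefficients, and lengthens each character by at
  -- most one.
  have hS : ∀ r ∈ lowerSpan c n.natAbs,
      (fun f => reflectRat d (r f)) ∈ lowerSpan c (n.natAbs + 1) := by
    intro r hr
    induction hr using Submodule.span_induction with
    | mem x hx =>
      obtain ⟨m, hm, rfl⟩ := hx
      refine Submodule.subset_span ⟨τ m, ?_, funext fun f => (hχ m f).symm⟩
      have := hτ_le m
      change m.natAbs < _ at hm
      change (τ m).natAbs < _
      omega
    | zero =>
      simp only [Pi.zero_apply, map_zero]
      exact zero_mem (lowerSpan c (n.natAbs + 1))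
    | add x y _ _ hx hy => simpa [Pi.add_def] using add_mem hx hy
    | smul u x _ hx => simpa [Pi.smul_def] using Submodule.smul_mem _ (reflectRat d u) hx
  refine ⟨β * reflectRat d k, mul_ne_zero hβ ((map_ne_zero _).2 hk), ?_⟩
  rw [hn]
  have hF : (fun f => toRat (w f)) ∈ lowerSpan c (n.natAbs + 1) := by
    rw [← sub_add_cancel (fun f => toRat (w f)) (k • character c n)]
    refine add_mem (Submodule.span_mono (Set.image_mono fun m hm => ?_) hmem)
      (Submodule.smul_mem _ _ (Submodule.subset_span ⟨n, by simp, rfl⟩))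
    exact Nat.lt_succ_of_lt hm
  convert add_mem (Submodule.smul_mem _ α hF) (Submodule.smul_mem _ β (hS _ hmem)) using 1
  funext f
  simp only [Pi.sub_apply, Pi.add_apply, Pi.smul_apply, smul_eq_mul, Module.End.mul_apply, ht,
    map_sub, map_mul, hχ, reflectRat_toRat]
  ring

theorem triangular_word (c : ℂˣ) (a b : ℂ) (n : ℤ) :
    ∃ k : Rational, k ≠ 0 ∧
      (fun f => toRat (word (opT0 c) (opT1 a b) n f)) - k • character c n
        ∈ lowerSpan c n.natAbs := by
  induction h : n.natAbs generalizing n with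
  | zero =>
    obtain rfl := Int.natAbs_eq_zero.1 h
    refine ⟨1, one_ne_zero, ?_⟩
    convert zero_mem (lowerSpan c 0)
    funext f
    simp [character, dihedral]
  | succ N ih =>
    rcases lt_or_ge 0 n with hn | hn
    -- The first letter is `T₀`; removing it leaves the word of index `1 - n`. In the other case it
    -- is `T₁`, leaving index `-1 - n`.
    · have hw := ih (1 - n) (by omega)
      have := triangular_step c c (1 - ·) (reflect_comp_dihedral c) (fun m => by omega) (opT0 c)
        (-(z / (const c - z ^ 2))) (z / (const c - z ^ 2))
        (div_ne_zero z_ne_zero (const_sub_z_sq_ne_zero c.ne_zero))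
        (fun f => by rw [toRat_opT0]; ring) _ (1 - n) (by omega)
        (by rwa [show (1 - n).natAbs = N by omega])
      rwa [mul_word_of_nonpos _ _ (by omega), sub_sub_cancel, h] at this
    · have hw := ih (-1 - n) (by omega)
      have := triangular_step c 1 (-1 - ·) (reflect_one_comp_dihedral c) (fun m => by omega)
        (opT1 a b) _ _
        (div_ne_zero (mul_ne_zero (linear_ne_zero a) (linear_ne_zero b)) one_sub_z_sq_ne_zero)
        (toRat_opT1 a b) _ (-1 - n) (by omega)
        (by rwa [show (-1 - n).natAbs = N by omega])
      rwa [mul_word_of_nonneg _ _ (by omega), sub_sub_cancel, h] at this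

theorem linearIndependent_word {c : ℂˣ} (hc : ∀ m : ℕ, 1 ≤ m → (c : ℂ) ^ m ≠ 1) (a b : ℂ) :
    LinearIndependent Rational
      fun (n : ℤ) (f : Laurent) => toRat (word (opT0 c) (opT1 a b) n f) :=
  linearIndependent_of_triangular (linearIndependent_character hc) (triangular_word c a b)

/-! ### Spanning by normally ordered words -/

section Exchange

variable {R : Type*} [Ring R] [Algebra ℂ R] {x y t : R}

theorem exchange_T0 {q : ℂ} (hyx : y * x = 1) (h : q • (t * y) + 1 = x * t) :
    t * x = q • (y * t) + 1 := by
  have h1 : y * (q • (t * y) + 1) * x = y * (x * t) * x := by rw [h]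
  rw [← mul_assoc y x t, hyx, one_mul] at h1
  rw [← h1, mul_add, add_mul, mul_smul_comm, smul_mul_assoc, mul_one, hyx, mul_assoc y (t * y) x,
    mul_assoc t, hyx, mul_one]

/-- As `ab ≠ 0`, the relation `h1` makes `t` invertible with inverse a multiple of `t + (1 + ab)`.
Multiplying `h2` by this factor and cancelling `ab` leaves a relation affine in `x t x`, `x` and
`t`; multiplication by `y` finishes. -/
theorem exchange_T1 {a b : ℂ} (ha : a ≠ 0) (hb : b ≠ 0) (hyx : y * x = 1)
    (h1 : (t + algebraMap ℂ R (a * b)) * (t + 1) = 0)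
    (h2 : (t * x + algebraMap ℂ R a) * (t * x + algebraMap ℂ R b) = 0) :
    t * x = y * t + (1 + a * b) • y - (a + b) • 1 := by
  simp only [Algebra.algebraMap_eq_smul_one] at h1 h2
  have hab : a * b ≠ 0 := mul_ne_zero ha hb
  have hinv : (t + (1 + a * b) • 1) * t = -((a * b) • (1 : R)) := by
    simp only [mul_add, add_mul, smul_mul_assoc, one_mul, mul_one] at h1 ⊢
    refine sub_eq_zero.1 (Eq.trans ?_ h1)
    module
  have hinv' : ∀ r : R, (t + (1 + a * b) • 1) * (t * r) = -((a * b) • r) := fun r => by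
    rw [← mul_assoc, hinv, neg_mul, smul_mul_assoc, one_mul]
  have h3 : (t + (1 + a * b) • 1) *
      ((t * x + a • 1) * (t * x + b • 1)) = 0 := by rw [h2, mul_zero]
  have h4 : x * (t * x) + (a + b) • x = t + (1 + a * b) • 1 := by
    have h5 : (t * x + a • 1) * (t * x + b • 1)
        = t * (x * (t * x) + (a + b) • x) + (a * b) • (1 : R) := by
      simp only [mul_add, add_mul, smul_mul_assoc, mul_smul_comm, one_mul, mul_one, mul_assoc]
      module
    rw [h5, mul_add, hinv', mul_smul_comm, mul_one, ← smul_neg, ← smul_add] at h3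
    rw [← sub_eq_zero, ← neg_eq_zero, neg_sub, sub_eq_add_neg, add_comm]
    exact (smul_eq_zero_iff_right hab).1 h3
  have h6 : y * (x * (t * x) + (a + b) • x) = y * (t + (1 + a * b) • 1) := by rw [h4]
  rw [mul_add, ← mul_assoc y, hyx, one_mul, mul_smul_comm, hyx, mul_add, mul_smul_comm,
    mul_one] at h6
  rw [← h6, add_sub_cancel_right]

end Exchange

variable {q a b : ℂ}

theorem gen_X_mul_Xinv : HIII.gen q a b .X * HIII.gen q a b .Xinv = 1 := by
  simpa [HIII.gen] using RingQuot.mkAlgHom_rel ℂ (Rel.X_mul_Xinv (q := q) (a := a) (b := b))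

theorem gen_Xinv_mul_X : HIII.gen q a b .Xinv * HIII.gen q a b .X = 1 := by
  simpa [HIII.gen] using RingQuot.mkAlgHom_rel ℂ (Rel.Xinv_mul_X (q := q) (a := a) (b := b))

theorem gen_T0_mul_self : HIII.gen q a b .T0 * HIII.gen q a b .T0 = 0 := by
  simpa [HIII.gen, pow_two] using
    RingQuot.mkAlgHom_rel ℂ (Rel.quadratic_T0 (q := q) (a := a) (b := b))

theorem gen_T1_quadratic :
    (HIII.gen q a b .T1 + algebraMap ℂ _ (a * b)) * (HIII.gen q a b .T1 + 1) = 0 := by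
  have := RingQuot.mkAlgHom_rel ℂ (Rel.quadratic_T1 (q := q) (a := a) (b := b))
  rwa [map_mul, map_add, map_add, AlgHom.commutes, map_one, map_zero] at this

theorem gen_T1_mul_X_quadratic :
    (HIII.gen q a b .T1 * HIII.gen q a b .X + algebraMap ℂ _ a) *
      (HIII.gen q a b .T1 * HIII.gen q a b .X + algebraMap ℂ _ b) = 0 := by
  have := RingQuot.mkAlgHom_rel ℂ (Rel.quadratic_T1X (q := q) (a := a) (b := b))
  rwa [map_mul, map_add, map_add, AlgHom.commutes, AlgHom.commutes, map_mul, map_zero] at this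

theorem gen_exchange :
    q • (HIII.gen q a b .T0 * HIII.gen q a b .Xinv) + 1 =
      HIII.gen q a b .X * HIII.gen q a b .T0 := by
  have := RingQuot.mkAlgHom_rel ℂ (Rel.exchange (q := q) (a := a) (b := b))
  rwa [map_add, map_mul, map_mul, AlgHom.commutes, map_one, map_mul, ← Algebra.smul_def,
    smul_mul_assoc] at this

theorem gen_T1_mul_self : HIII.gen q a b .T1 * HIII.gen q a b .T1 =
    (-(1 + a * b)) • HIII.gen q a b .T1 - (a * b) • 1 := by
  have h := gen_T1_quadratic (q := q) (a := a) (b := b)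
  simp only [Algebra.algebraMap_eq_smul_one, mul_add, add_mul, smul_mul_assoc, one_mul,
    mul_one] at h
  refine sub_eq_zero.1 (Eq.trans ?_ h)
  module

variable (q a b) in
/-- The generator `X` as a unit. -/
def unitX : (HIII q a b)ˣ :=
  ⟨HIII.gen q a b .X, HIII.gen q a b .Xinv, gen_X_mul_Xinv, gen_Xinv_mul_X⟩

variable (q a b) in
/-- The homomorphism from Laurent polynomials to `H_III` which sends the variable to `X`. -/
def ofLaurent : Laurent →ₐ[ℂ] HIII q a b :=
  AddMonoidAlgebra.lift ℂ (HIII q a b) ℤ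
    ((Units.coeHom _).comp (zpowersHom _ (unitX q a b)))

theorem ofLaurent_T (n : ℤ) :
    ofLaurent q a b (T n) = ((unitX q a b ^ n : (HIII q a b)ˣ) : HIII q a b) := by
  rw [ofLaurent, T, AddMonoidAlgebra.lift_single, one_smul]
  rfl

theorem ofLaurent_T_one : ofLaurent q a b (T 1) = HIII.gen q a b .X := by
  rw [ofLaurent_T, zpow_one]
  rfl

theorem ofLaurent_T_neg_one : ofLaurent q a b (T (-1)) = HIII.gen q a b .Xinv := by
  rw [ofLaurent_T, zpow_neg_one]
  rfl

/-- An element `t` which can be moved past `X` and `X⁻¹` can be moved past Laurent polynomials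
in `X`. -/
theorem exists_mul_ofLaurent {t : HIII q a b}
    (h1 : ∃ g h, t * HIII.gen q a b .X = ofLaurent q a b g * t + ofLaurent q a b h)
    (h2 : ∃ g h, t * HIII.gen q a b .Xinv = ofLaurent q a b g * t + ofLaurent q a b h)
    (f : Laurent) :
    ∃ g h, t * ofLaurent q a b f = ofLaurent q a b g * t + ofLaurent q a b h := by
  have hmul : ∀ {f f' : Laurent},
      (∃ g h, t * ofLaurent q a b f = ofLaurent q a b g * t + ofLaurent q a b h) →
      (∃ g h, t * ofLaurent q a b f' = ofLaurent q a b g * t + ofLaurent q a b h) →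
      ∃ g h, t * ofLaurent q a b (f * f') = ofLaurent q a b g * t + ofLaurent q a b h := by
    rintro f f' ⟨g, h, e⟩ ⟨g', h', e'⟩
    refine ⟨g * g', g * h' + h * f', ?_⟩
    rw [map_mul, ← mul_assoc, e, add_mul, mul_assoc, e']
    simp only [map_mul, map_add, mul_add, mul_assoc, add_assoc]
  rw [← ofLaurent_T_one] at h1
  rw [← ofLaurent_T_neg_one] at h2
  induction f using LaurentPolynomial.induction_on with
  | h_C x =>
    refine ⟨C x, 0, ?_⟩
    rw [map_zero, add_zero, C_eq_algebraMap, AlgHom.commutes, Algebra.commutes]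
  | h_add hf hg =>
    obtain ⟨g, h, e⟩ := hf
    obtain ⟨g', h', e'⟩ := hg
    refine ⟨g + g', h + h', ?_⟩
    rw [map_add, mul_add, e, e', map_add, map_add, add_mul]
    abel
  | h_C_mul_T n x hf =>
    rw [T_add, ← mul_assoc]
    exact hmul hf h1
  | h_C_mul_T_Z n x hf =>
    rw [sub_eq_add_neg, T_add, ← mul_assoc]
    exact hmul hf h2

theorem exists_T0_mul_ofLaurent (hq : q ≠ 0) (f : Laurent) :
    ∃ g h, HIII.gen q a b .T0 * ofLaurent q a b f =
      ofLaurent q a b g * HIII.gen q a b .T0 + ofLaurent q a b h := by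
  -- The second pair solves the exchange relation for `T₀ X⁻¹`, which requires dividing by `q`.
  refine exists_mul_ofLaurent ⟨C q * T (-1), 1, ?_⟩ ⟨C q⁻¹ * T 1, -C q⁻¹, ?_⟩ f
  · rw [exchange_T0 gen_Xinv_mul_X gen_exchange, ← smul_eq_C_mul, map_smul,
      ofLaurent_T_neg_one, smul_mul_assoc, map_one]
  · rw [← smul_eq_C_mul, map_smul, ofLaurent_T_one, smul_mul_assoc, ← gen_exchange, smul_add,
      inv_smul_smul₀ hq, map_neg, C_eq_algebraMap, AlgHom.commutes,
      Algebra.algebraMap_eq_smul_one, add_neg_cancel_right]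

theorem exists_T1_mul_ofLaurent (ha : a ≠ 0) (hb : b ≠ 0) (f : Laurent) :
    ∃ g h, HIII.gen q a b .T1 * ofLaurent q a b f =
      ofLaurent q a b g * HIII.gen q a b .T1 + ofLaurent q a b h := by
  have h := exchange_T1 ha hb gen_Xinv_mul_X gen_T1_quadratic (gen_T1_mul_X_quadratic (q := q))
  refine exists_mul_ofLaurent ⟨T (-1), (1 + a * b) • T (-1) - (a + b) • 1, ?_⟩
    ⟨T 1, (a + b) • 1 - (1 + a * b) • T (-1), ?_⟩ f
  · rw [h, map_sub, map_smul, map_smul, map_one, ofLaurent_T_neg_one, add_sub_assoc]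
  · rw [map_sub, map_smul, map_smul, map_one, ofLaurent_T_neg_one, ofLaurent_T_one]
    -- Conjugating the rule for `T₁ X` by `X` turns it into a rule for `T₁ X⁻¹`.
    have h' := congrArg (fun r => HIII.gen q a b .X * r * HIII.gen q a b .Xinv) h
    simp only [mul_add, add_mul, mul_sub, sub_mul, mul_smul_comm, smul_mul_assoc, mul_one,
      mul_assoc, gen_X_mul_Xinv] at h'
    simp only [← mul_assoc, gen_X_mul_Xinv, one_mul] at h'
    rw [h']
    abel

variable (q a b) in
/-- The words in `T₀` and `T₁`. -/
abbrev wordT (n : ℤ) : HIII q a b := word (HIII.gen q a b .T0) (HIII.gen q a b .T1) n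

variable (q a b) in
/-- The linear combination of words in `T₀`, `T₁` with Laurent polynomials in `X` as
coefficients. -/
def normalForm : (ℤ →₀ Laurent) →ₗ[ℂ] HIII q a b :=
  Finsupp.lsum ℂ fun n => (LinearMap.mulRight ℂ (wordT q a b n)).comp (ofLaurent q a b).toLinearMap

theorem normalForm_apply (l : ℤ →₀ Laurent) :
    normalForm q a b l = l.sum fun n f => ofLaurent q a b f * wordT q a b n := rfl

theorem ofLaurent_mul_word_mem (f : Laurent) (n : ℤ) :
    ofLaurent q a b f * wordT q a b n ∈ LinearMap.range (normalForm q a b) := by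
  refine ⟨Finsupp.single n f, ?_⟩
  rw [normalForm_apply, Finsupp.sum_single_index (by rw [map_zero, zero_mul])]

theorem ofLaurent_mul_mem {r : HIII q a b} (f : Laurent)
    (hr : r ∈ LinearMap.range (normalForm q a b)) :
    ofLaurent q a b f * r ∈ LinearMap.range (normalForm q a b) := by
  obtain ⟨l, rfl⟩ := hr
  rw [normalForm_apply, Finsupp.mul_sum]
  refine Submodule.sum_mem _ fun n _ => ?_
  beta_reduce
  rw [← mul_assoc, ← map_mul]
  exact ofLaurent_mul_word_mem _ _

theorem word_mem (n : ℤ) : wordT q a b n ∈ LinearMap.range (normalForm q a b) := by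
  simpa using ofLaurent_mul_word_mem (q := q) (a := a) (b := b) 1 n

theorem T0_mul_word_mem (n : ℤ) :
    HIII.gen q a b .T0 * wordT q a b n ∈ LinearMap.range (normalForm q a b) := by
  rcases le_or_gt n 0 with hn | hn
  · rw [mul_word_of_nonpos _ _ hn]
    exact word_mem _
  · have h := mul_word_of_nonpos (HIII.gen q a b .T0) (HIII.gen q a b .T1) (n := 1 - n) (by omega)
    rw [sub_sub_cancel] at h
    rw [wordT, ← h, ← mul_assoc, gen_T0_mul_self, zero_mul]
    exact zero_mem _

theorem T1_mul_word_mem (n : ℤ) :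
    HIII.gen q a b .T1 * wordT q a b n ∈ LinearMap.range (normalForm q a b) := by
  rcases le_or_gt 0 n with hn | hn
  · rw [mul_word_of_nonneg _ _ hn]
    exact word_mem _
  · have h := mul_word_of_nonneg (HIII.gen q a b .T0) (HIII.gen q a b .T1) (n := -1 - n) (by omega)
    rw [sub_sub_cancel] at h
    rw [wordT, ← h, ← mul_assoc, gen_T1_mul_self, sub_mul, smul_mul_assoc, smul_mul_assoc,
      one_mul, h]
    exact sub_mem (Submodule.smul_mem _ _ (word_mem _)) (Submodule.smul_mem _ _ (word_mem _))

theorem mul_mem_of_exists {t : HIII q a b}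
    (ht : ∀ f, ∃ g h, t * ofLaurent q a b f = ofLaurent q a b g * t + ofLaurent q a b h)
    (hw : ∀ n, t * wordT q a b n ∈ LinearMap.range (normalForm q a b)) {r : HIII q a b}
    (hr : r ∈ LinearMap.range (normalForm q a b)) :
    t * r ∈ LinearMap.range (normalForm q a b) := by
  obtain ⟨l, rfl⟩ := hr
  rw [normalForm_apply, Finsupp.mul_sum]
  refine Submodule.sum_mem _ fun n _ => ?_
  obtain ⟨g, h, e⟩ := ht (l n)
  simp only [← mul_assoc, e, add_mul]
  rw [mul_assoc]
  exact add_mem (ofLaurent_mul_mem g (hw n)) (ofLaurent_mul_word_mem h n)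

/-- The range contains 1 and is stable under left multiplication by every generator, hence is a left
ideal containing 1. -/
theorem normalForm_surjective (hq : q ≠ 0) (ha : a ≠ 0) (hb : b ≠ 0) :
    Function.Surjective (normalForm q a b) := by
  have key : ∀ (w : FreeAlgebra ℂ Gen), ∀ r ∈ LinearMap.range (normalForm q a b),
      RingQuot.mkAlgHom ℂ (Rel q a b) w * r ∈ LinearMap.range (normalForm q a b) := by
    intro w
    induction w using FreeAlgebra.induction with
    | grade0 x =>
      intro r hr
      rw [AlgHom.commutes, ← Algebra.smul_def]
      exact Submodule.smul_mem _ _ hr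
    | grade1 g =>
      intro r hr
      change HIII.gen q a b g * r ∈ _
      cases g with
      | T0 => exact mul_mem_of_exists (exists_T0_mul_ofLaurent hq) T0_mul_word_mem hr
      | T1 => exact mul_mem_of_exists (exists_T1_mul_ofLaurent ha hb) T1_mul_word_mem hr
      | X =>
        rw [← ofLaurent_T_one]
        exact ofLaurent_mul_mem _ hr
      | Xinv =>
        rw [← ofLaurent_T_neg_one]
        exact ofLaurent_mul_mem _ hr
    | mul u v hu hv =>
      intro r hr
      rw [map_mul, mul_assoc]
      exact hu _ (hv _ hr)
    | add u v hu hv =>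
      intro r hr
      rw [map_add, add_mul]
      exact add_mem (hu _ hr) (hv _ hr)
  intro r
  obtain ⟨w, rfl⟩ := RingQuot.mkAlgHom_surjective ℂ (Rel q a b) r
  simpa using key w 1 (word_mem 0)

/-! ### Faithfulness -/

theorem map_word {R S : Type*} [Monoid R] [Monoid S] (φ : R →* S) (u v : R) (n : ℤ) :
    φ (word u v n) = word (φ u) (φ v) n := by
  have h : ∀ (k : ℕ) (u v : R), φ (alternating u v k) = alternating (φ u) (φ v) k := by
    intro k
    induction k with
    | zero => exact fun _ _ => map_one φ
    | succ k ih => exact fun u v => by rw [alternating, map_mul, ih, alternating]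
  rcases n with n | n
  · exact h _ _ _
  · exact h _ _ _

theorem representation_ofLaurent (c : ℂˣ) (f : Laurent) :
    representation c a b (ofLaurent c a b f) = mulOp f := by
  have : ((representation c a b).comp (ofLaurent c a b) : Laurent →+* Module.End ℂ Laurent) =
      (Algebra.lmul ℂ Laurent : Laurent →+* Module.End ℂ Laurent) := by
    refine laurent_hom_ext (fun x => ?_) ?_
    · simp only [C_eq_algebraMap, RingHom.coe_coe, AlgHom.commutes]
    · change representation c a b (ofLaurent c a b (T 1)) = mulOp (T 1)
      rw [ofLaurent_T_one, representation_gen, opGen]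
  exact DFunLike.congr_fun this f

theorem representation_wordT (c : ℂˣ) (n : ℤ) :
    representation c a b (wordT c a b n) = word (opT0 c) (opT1 a b) n := by
  have := map_word (representation c a b : HIII c a b →* Module.End ℂ Laurent)
    (HIII.gen c a b .T0) (HIII.gen c a b .T1) n
  simpa [opGen] using this

theorem representation_injective (c : ℂˣ) (ha : a ≠ 0) (hb : b ≠ 0)
    (hc : ∀ m : ℕ, 1 ≤ m → (c : ℂ) ^ m ≠ 1) : Function.Injective (representation c a b) := by
  rw [injective_iff_map_eq_zero]
  intro r hr
  obtain ⟨l, rfl⟩ := normalForm_surjective c.ne_zero ha hb r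
  -- The Laurent coefficients are read as rational functions, over which the words are independent;
  -- `toRat` being injective, they vanish already as Laurent polynomials.
  have hind := linearIndependent_iff.1 (linearIndependent_word hc a b)
    (l.mapRange toRat (map_zero _)) <| by
      funext f
      have h := congrArg toRat (DFunLike.congr_fun hr f)
      rw [normalForm_apply, map_finsuppSum, Finsupp.sum, LinearMap.sum_apply, map_sum] at h
      rw [Finsupp.linearCombination_apply, Finsupp.sum_mapRange_index (by simp), Finsupp.sum,
        Finset.sum_apply, Pi.zero_apply]
      simpa [representation_ofLaurent, representation_wordT] using h
  have : l = 0 := Finsupp.mapRange_injective _ (map_zero _) toRat_injective (by simpa using hind)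
  rw [this, map_zero]

end ConfluentCherednik

end

theorem theorem3p1 (q a b : ℂ) (hq : q ≠ 0) (ha : a ≠ 0) (hb : b ≠ 0)
    (hroot : ∀ m : ℕ, 1 ≤ m → q ^ m ≠ 1) :
    ∃ ρ : ConfluentCherednik.HIII q a b →ₐ[ℂ] Module.End ℂ ConfluentCherednik.Laurent,
      (∀ f : ConfluentCherednik.Laurent,
        ConfluentCherednik.toRat (ρ (ConfluentCherednik.HIII.gen q a b .T0) f) =
          -(ConfluentCherednik.z / (ConfluentCherednik.const q - ConfluentCherednik.z ^ 2)) *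
            (ConfluentCherednik.toRat f -
              ConfluentCherednik.toRat (ConfluentCherednik.reflect (Units.mk0 q hq) f))) ∧
      (∀ f : ConfluentCherednik.Laurent,
        ConfluentCherednik.toRat (ρ (ConfluentCherednik.HIII.gen q a b .T1) f) =
          (ConfluentCherednik.const (a + b) * ConfluentCherednik.z
              - ConfluentCherednik.const (1 + a * b)) / (1 - ConfluentCherednik.z ^ 2) *
            ConfluentCherednik.toRat f +
          (1 - ConfluentCherednik.const a * ConfluentCherednik.z) *
              (1 - ConfluentCherednik.const b * ConfluentCherednik.z) /
              (1 - ConfluentCherednik.z ^ 2) *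
            ConfluentCherednik.toRat (ConfluentCherednik.reflect 1 f)) ∧
      (∀ f : ConfluentCherednik.Laurent,
        ρ (ConfluentCherednik.HIII.gen q a b .X) f = LaurentPolynomial.T 1 * f) ∧
      Function.Injective ρ := by
  obtain ⟨c, rfl⟩ : ∃ c : ℂˣ, (c : ℂ) = q := ⟨Units.mk0 q hq, rfl⟩
  rw [Units.mk0_val]
  refine ⟨ConfluentCherednik.representation c a b, fun f => ?_, fun f => ?_, fun f => ?_,
    ConfluentCherednik.representation_injective c ha hb hroot⟩ <;>
    rw [ConfluentCherednik.representation_gen]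
  · exact ConfluentCherednik.toRat_opT0 c f
  · exact ConfluentCherednik.toRat_opT1 a b f
  · rfl
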